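/- Let $G=[g_{ij}]$ be a nonsingular complex $N\times N$ matrix with $G^t=\pm G$, write $G^{-1}=[\overline g_{ij}]$, and let the upper sign refer to the symmetric and the lower sign to the skew-symmetric case. Let $E_{ij}$ be the standard basis of $\mathfrak{gl}_N$, put $F_{ij}=E_{ij}-\sum_{k,l=1}^N g_{ik}\,\overline g_{lj}\,E_{lk}$, and let $\mathfrak g_N\subset\mathfrak{gl}_N$ be the Lie subalgebra spanned by the $F_{ij}$ (so $\mathfrak g_N\cong\mathfrak o_N$ in the symmetric and $\mathfrak g_N\cong\mathfrak{sp}_N$ in the skew-symmetric case). Let $F=[F_{ij}]$, regarded as the $N\times N$ matrix $\sum_{i,j} e_{ij}\otimes F_{ij}\in\operatorname{End}\mathbb C^N\otimes \mathrm U(\mathfrak g_N)$, where $e_{ij}$ are the matrix units. Let $\kappa=N/2\mp1$, $P=\sum_{i,j}e_{ij}\otimes e_{ji}$, $Q=G_1\big(\sum_{i,j}e_{ij}\otimes e_{ij}\big)G_1^{-1}$ with $G_1=G\otimes 1$, and $$R(u)=1-\frac{P}{u}+\frac{Q}{u-\kappa}.$$ The reflection algebra $\mathrm B(\mathfrak g_N)$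 is the unital associative $\mathbb C$-algebra with generators $s_{ij}^{(r)}$, $1\le i,j\le N$, $r\ge1$, and defining relations $$R(u-v)\,S_1(u)\,R(u+v)\,S_2(v)=S_2(v)\,R(u+v)\,S_1(u)\,R(u-v),\qquad S(u)\,S(-u)=1,$$ where $S(u)=\sum_{i,j}e_{ij}\otimes s_{ij}(u)$ with $s_{ij}(u)=\delta_{ij}+\sum_{r\ge1}s_{ij}^{(r)}u^{-r}$, the indices $1,2$ of $S_1=\sum e_{ij}\otimes1\otimes s_{ij}$ and $S_2=\sum 1\otimes e_{ij}\otimes s_{ij}$ indicate the copy of $\operatorname{End}\mathbb C^N$, and the rational functions of $u,v$ are expanded into series in $v^{-1}$, so that the first relation is an identity of formal series with coefficients in the algebra. Then the matrix $u-F+N/4$ is invertible over $\mathrm U(\mathfrak g_N)((u^{-1}))$, and the mapping $$S(u)\mapsto\frac{u+F-N/4}{u-F+N/4}=1+2\sum_{r=1}^{\infty}\Big(F-\frac N4\Big)^{r}u^{-r}$$ defines an algebra homomorphism $\mathrm B(\mathfrak g_N)\to\mathrm U(\mathfrak g_N)$; that is, the displayed equality holds and there is a unique homomorphism of unital $\mathbb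 C$-algebras $\mathrm B(\mathfrak g_N)\to\mathrm U(\mathfrak g_N)$ which, applied to the coefficients of $S(u)$, gives this matrix. -/

import Mathlib

open scoped Matrix Kronecker PowerSeries LaurentSeries

noncomputable section

namespace ReflectionAlgebra

/-! ### The orthogonal and symplectic Lie algebras -/

section LieAlg

attribute [local instance 100] LieRing.ofAssociativeRing

variable {N : ℕ}

/-- `F_ij = E_ij - ∑_{k,l} g_ik ḡ_lj E_lk`, where `G = [g_ij]` and `G⁻¹ = [ḡ_ij]`. -/
def lieF (G : Matrix (Fin N) (Fin N) ℂ) (i j : Fin N) : Matrix (Fin N) (Fin N) ℂ :=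
  Matrix.single i j 1 - ∑ k, ∑ l, (G i k * G⁻¹ l j) • Matrix.single l k (1 : ℂ)

/-- The Lie subalgebra `𝔤_N` of `𝔤𝔩_N` spanned by the elements `F_ij`. It is `𝔬_N` for symmetric
nonsingular `G` and `𝔰𝔭_N` for skew-symmetric nonsingular `G`. -/
def gN (G : Matrix (Fin N) (Fin N) ℂ) : LieSubalgebra ℂ (Matrix (Fin N) (Fin N) ℂ) :=
  LieSubalgebra.lieSpan ℂ _ (Set.range fun p : Fin N × Fin N => lieF G p.1 p.2)

theorem lieF_mem_gN (G : Matrix (Fin N) (Fin N) ℂ) (i j : Fin N) : lieF G i j ∈ gN G :=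
  LieSubalgebra.subset_lieSpan ⟨(i, j), rfl⟩

/-- The universal enveloping algebra `U(𝔤_N)`. -/
abbrev UgN (G : Matrix (Fin N) (Fin N) ℂ) : Type :=
  UniversalEnvelopingAlgebra ℂ (gN G)

/-- The matrix `F = [F_ij]` with entries in `U(𝔤_N)`. -/
def matF (G : Matrix (Fin N) (Fin N) ℂ) : Matrix (Fin N) (Fin N) (UgN G) :=
  Matrix.of fun i j => UniversalEnvelopingAlgebra.ι ℂ (⟨lieF G i j, lieF_mem_gN G i j⟩ : gN G)

theorem lieF_eq (G : Matrix (Fin N) (Fin N) ℂ) (i j : Fin N) :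
    lieF G i j = Matrix.single i j 1 - G⁻¹ * (Matrix.single i j 1)ᵀ * G := by
  unfold lieF
  congr 1
  ext a b
  simp [Matrix.sum_apply, Matrix.mul_apply, Matrix.single_apply, ite_and, mul_comm]

/-- For nonsingular symmetric or skew-symmetric `G`, the Lie algebra `𝔤_N` consists of all matrices
that are skew-adjoint for the bilinear form of `G`. -/
theorem gN_eq_skewAdjoint (G : Matrix (Fin N) (Fin N) ℂ) (hdet : IsUnit G.det) (ε : ℤˣ)
    (hG : Gᵀ = ((ε : ℤ) : ℂ) • G) : gN G = skewAdjointMatricesLieSubalgebra G := by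
  have hu : G⁻¹ * G = 1 := Matrix.nonsing_inv_mul G hdet
  have hu' : G * G⁻¹ = 1 := Matrix.mul_nonsing_inv G hdet
  have hε : ((ε : ℤ) : ℂ) * ((ε : ℤ) : ℂ) = 1 := by
    rcases Int.units_eq_one_or ε with h | h <;> simp [h]
  have hGi : (G⁻¹)ᵀ = ((ε : ℤ) : ℂ) • G⁻¹ := by
    have h1 : (((ε : ℤ) : ℂ) • G⁻¹) * Gᵀ = 1 := by
      rw [hG, Matrix.smul_mul, Matrix.mul_smul, smul_smul, hε, hu, one_smul]
    rw [Matrix.transpose_nonsing_inv]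
    exact Matrix.inv_eq_left_inv h1
  apply le_antisymm
  · refine LieSubalgebra.lieSpan_le.2 ?_
    rintro _ ⟨⟨i, j⟩, rfl⟩
    have key : (lieF G i j)ᵀ * G = G * (-lieF G i j) := by
      rw [lieF_eq]
      simp only [Matrix.transpose_sub, Matrix.transpose_mul, Matrix.transpose_transpose, hG, hGi,
        Matrix.smul_mul, Matrix.mul_smul, smul_smul, hε, one_smul, sub_mul, neg_sub, mul_sub]
      simp only [Matrix.mul_assoc, hu, Matrix.mul_one]
      rw [← Matrix.mul_assoc G G⁻¹, hu', Matrix.one_mul]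
    rw [SetLike.mem_coe, mem_skewAdjointMatricesLieSubalgebra, mem_skewAdjointMatricesSubmodule]
    exact key
  · intro A hA
    have hA' : Aᵀ * G = G * (-A) := by
      rw [mem_skewAdjointMatricesLieSubalgebra, mem_skewAdjointMatricesSubmodule] at hA
      exact hA
    have h2 : G⁻¹ * Aᵀ * G = -A := by
      rw [Matrix.mul_assoc, hA', ← Matrix.mul_assoc, hu, Matrix.one_mul]
    have h3 : ∑ i, ∑ j, A i j • lieF G i j = A - G⁻¹ * Aᵀ * G := by
      conv_rhs => rw [Matrix.matrix_eq_sum_single A]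
      simp only [lieF_eq, smul_sub, Finset.sum_sub_distrib, Matrix.transpose_sum,
        Matrix.mul_sum, Matrix.sum_mul]
      congr 1
      · simp
      · refine Finset.sum_congr rfl fun i _ => Finset.sum_congr rfl fun j _ => ?_
        rw [← Matrix.smul_mul, ← Matrix.mul_smul]
        simp
    have h4 : A = (1 / 2 : ℂ) • ∑ i, ∑ j, A i j • lieF G i j := by
      rw [h3, h2, sub_neg_eq_add, ← two_smul ℂ A, smul_smul]
      norm_num
    rw [h4]
    exact (gN G).smul_mem _ (sum_mem fun i _ => sum_mem fun j _ =>
      (gN G).smul_mem _ (lieF_mem_gN G i j))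

end LieAlg

/-! ### Laurent series in `u⁻¹` and `v⁻¹`

`A⸨X⸩` stands for `A((u⁻¹))`, with `X = u⁻¹`. Identities in `u` and `v` are read in the iterated
ring `A((u⁻¹))((v⁻¹))`, where rational functions such as `(u - v)⁻¹` are expanded into series in
`v⁻¹`. -/

section Series

/-- The map `A((X)) → B((X))` induced on coefficients by a ring homomorphism `A → B`. -/
def mapLaurent {A B : Type*} [Ring A] [Ring B] (f : A →+* B) : A⸨X⸩ →+* B⸨X⸩ where
  toFun x := x.map f
  map_one' := HahnSeries.map_one f.toMonoidWithZeroHom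
  map_mul' _ _ := HahnSeries.map_mul (f : A →ₙ+* B)
  map_zero' := by ext; simp
  map_add' _ _ := HahnSeries.map_add (f : A →+ B)

/-- `A((u⁻¹))((v⁻¹))`. -/
abbrev Laurent₂ (A : Type*) [Ring A] : Type _ := LaurentSeries (LaurentSeries A)

/-- The substitution `f(u) ∈ A[[u⁻¹]] ↦ f(u) ∈ A((u⁻¹))((v⁻¹))`. -/
def inU (A : Type*) [Ring A] : A⟦X⟧ →+* Laurent₂ A :=
  (HahnSeries.C : LaurentSeries A →+* Laurent₂ A).comp (HahnSeries.ofPowerSeries ℤ A)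

/-- The substitution `f(u) ∈ A[[u⁻¹]] ↦ f(v) ∈ A((u⁻¹))((v⁻¹))`. -/
def inV (A : Type*) [Ring A] : A⟦X⟧ →+* Laurent₂ A :=
  (HahnSeries.ofPowerSeries ℤ (LaurentSeries A)).comp
    (PowerSeries.map (HahnSeries.C : A →+* LaurentSeries A))

/-- The variable `u`, as an element of `ℂ((u⁻¹))((v⁻¹))`. -/
def varU : Laurent₂ ℂ := HahnSeries.C (HahnSeries.single (-1) 1)

/-- The variable `v`, as an element of `ℂ((u⁻¹))((v⁻¹))`. -/
def varV : Laurent₂ ℂ := HahnSeries.single (-1) 1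

/-- Complex constants in `ℂ((u⁻¹))((v⁻¹))`. -/
def const₂ : ℂ →+* Laurent₂ ℂ :=
  (HahnSeries.C : LaurentSeries ℂ →+* Laurent₂ ℂ).comp HahnSeries.C

/-- The canonical map `ℂ((u⁻¹))((v⁻¹)) → A((u⁻¹))((v⁻¹))`. -/
def scalars₂ (A : Type*) [Ring A] [Algebra ℂ A] : Laurent₂ ℂ →+* Laurent₂ A :=
  mapLaurent (mapLaurent (algebraMap ℂ A))

/-- The substitution `f(u) ↦ f(-u)` on `A[[u⁻¹]]`. -/
def negArg {A : Type*} [Ring A] (f : A⟦X⟧) : A⟦X⟧ :=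
  PowerSeries.mk fun n => (-1) ^ n * PowerSeries.coeff n f

end Series

/-! ### The `R`-matrix -/

section RMatrix

variable {N : ℕ}

/-- The permutation operator `P = ∑ e_ij ⊗ e_ji`. -/
def opP (N : ℕ) : Matrix (Fin N × Fin N) (Fin N × Fin N) ℂ :=
  ∑ i, ∑ j, Matrix.single i j 1 ⊗ₖ Matrix.single j i 1

/-- The partial transpose `Pᵗ = ∑ e_ij ⊗ e_ij`. -/
def opPt (N : ℕ) : Matrix (Fin N × Fin N) (Fin N × Fin N) ℂ :=
  ∑ i, ∑ j, Matrix.single i j 1 ⊗ₖ Matrix.single i j 1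

/-- `Q = G₁ Pᵗ G₁⁻¹`. -/
def opQ (G : Matrix (Fin N) (Fin N) ℂ) : Matrix (Fin N × Fin N) (Fin N × Fin N) ℂ :=
  (G ⊗ₖ 1) * opPt N * (G⁻¹ ⊗ₖ 1)

/-- `κ = N/2 ∓ 1`, the sign `ε` being `1` in the symmetric and `-1` in the skew-symmetric case. -/
def kappa (N : ℕ) (ε : ℤˣ) : ℂ := (N : ℂ) / 2 - ((ε : ℤ) : ℂ)

/-- `R(z) = 1 - P/z + Q/(z - κ)`, for `z` in the field `ℂ((u⁻¹))((v⁻¹))`. -/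
def opR (G : Matrix (Fin N) (Fin N) ℂ) (ε : ℤˣ) (z : Laurent₂ ℂ) :
    Matrix (Fin N × Fin N) (Fin N × Fin N) (Laurent₂ ℂ) :=
  1 - z⁻¹ • (opP N).map const₂ + (z - const₂ (kappa N ε))⁻¹ • (opQ G).map const₂

end RMatrix

/-! ### The reflection algebra -/

section Reflection

variable {N : ℕ}

/-- The matrix `[δ_ij + ∑_{r ≥ 1} s_ij^(r) u^{-r}]` with entries in `A[[u⁻¹]]`. -/
def genMatrix {A : Type*} [Ring A] (s : Fin N → Fin N → ℕ+ → A) :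
    Matrix (Fin N) (Fin N) A⟦X⟧ :=
  Matrix.of fun i j => PowerSeries.mk fun n =>
    if h : 0 < n then s i j ⟨n, h⟩ else if i = j then 1 else 0

/-- `R(u - v) S₁(u) R(u + v) S₂(v)`, with `S₁ = S ⊗ 1` and `S₂ = 1 ⊗ S`. -/
def reflLHS {A : Type*} [Ring A] [Algebra ℂ A] (G : Matrix (Fin N) (Fin N) ℂ) (ε : ℤˣ)
    (S : Matrix (Fin N) (Fin N) A⟦X⟧) :
    Matrix (Fin N × Fin N) (Fin N × Fin N) (Laurent₂ A) :=
  (opR G ε (varU - varV)).map (scalars₂ A) * (S.map (inU A) ⊗ₖ 1) *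
    (opR G ε (varU + varV)).map (scalars₂ A) * (1 ⊗ₖ S.map (inV A))

/-- `S₂(v) R(u + v) S₁(u) R(u - v)`. -/
def reflRHS {A : Type*} [Ring A] [Algebra ℂ A] (G : Matrix (Fin N) (Fin N) ℂ) (ε : ℤˣ)
    (S : Matrix (Fin N) (Fin N) A⟦X⟧) :
    Matrix (Fin N × Fin N) (Fin N × Fin N) (Laurent₂ A) :=
  (1 ⊗ₖ S.map (inV A)) * (opR G ε (varU + varV)).map (scalars₂ A) *
    (S.map (inU A) ⊗ₖ 1) * (opR G ε (varU - varV)).map (scalars₂ A)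

/-- The free associative algebra on the symbols `s_ij^(r)`, `1 ≤ i, j ≤ N`, `r ≥ 1`. -/
abbrev FreeB (N : ℕ) : Type := FreeAlgebra ℂ (Fin N × Fin N × ℕ+)

/-- The matrix `S(u)` over the free algebra. -/
def freeS (N : ℕ) : Matrix (Fin N) (Fin N) (FreeB N)⟦X⟧ :=
  genMatrix fun i j r => FreeAlgebra.ι ℂ (i, j, r)

/-- The defining relations: all coefficients of all matrix entries of the reflection equation
`R(u - v) S₁(u) R(u + v) S₂(v) = S₂(v) R(u + v) S₁(u) R(u - v)` and of the unitary condition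
`S(u) S(-u) = 1`. -/
inductive Rel (G : Matrix (Fin N) (Fin N) ℂ) (ε : ℤˣ) : FreeB N → FreeB N → Prop
  | reflection (p q : Fin N × Fin N) (m n : ℤ) :
      Rel G ε (((reflLHS G ε (freeS N) p q).coeff m).coeff n)
        (((reflRHS G ε (freeS N) p q).coeff m).coeff n)
  | unitary (i j : Fin N) (n : ℕ) :
      Rel G ε (PowerSeries.coeff n ((freeS N * (freeS N).map negArg) i j))
        (PowerSeries.coeff n ((1 : Matrix (Fin N) (Fin N) (FreeB N)⟦X⟧) i j))

/-- The reflection algebra `B(𝔤_N)`. -/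
abbrev B (G : Matrix (Fin N) (Fin N) ℂ) (ε : ℤˣ) : Type := RingQuot (Rel G ε)

/-- The generator `s_ij^(r)` of `B(𝔤_N)`. -/
def genB (G : Matrix (Fin N) (Fin N) ℂ) (ε : ℤˣ) (i j : Fin N) (r : ℕ+) : B G ε :=
  RingQuot.mkAlgHom ℂ (Rel G ε) (FreeAlgebra.ι ℂ (i, j, r))

/-- The matrix `S(u)` over `B(𝔤_N)[[u⁻¹]]`. -/
def matS (G : Matrix (Fin N) (Fin N) ℂ) (ε : ℤˣ) : Matrix (Fin N) (Fin N) (B G ε)⟦X⟧ :=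
  genMatrix (genB G ε)

end Reflection

/-! ### The evaluation -/

section Evaluation

variable {N : ℕ}

/-- The matrix `F - N/4` over `U(𝔤_N)`. -/
def shiftF (G : Matrix (Fin N) (Fin N) ℂ) : Matrix (Fin N) (Fin N) (UgN G) :=
  matF G - ((N : ℂ) / 4) • (1 : Matrix (Fin N) (Fin N) (UgN G))

/-- The matrix `u + F - N/4` over `U(𝔤_N)((u⁻¹))`. -/
def evalNum (G : Matrix (Fin N) (Fin N) ℂ) : Matrix (Fin N) (Fin N) (UgN G)⸨X⸩ :=
  Matrix.scalar (Fin N) (HahnSeries.single (-1) 1) + (shiftF G).map HahnSeries.C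

/-- The matrix `u - F + N/4` over `U(𝔤_N)((u⁻¹))`. -/
def evalDen (G : Matrix (Fin N) (Fin N) ℂ) : Matrix (Fin N) (Fin N) (UgN G)⸨X⸩ :=
  Matrix.scalar (Fin N) (HahnSeries.single (-1) 1) - (shiftF G).map HahnSeries.C

/-- The matrix `1 + 2 ∑_{r ≥ 1} (F - N/4)^r u^{-r}` over `U(𝔤_N)[[u⁻¹]]`. -/
def evalSeries (G : Matrix (Fin N) (Fin N) ℂ) : Matrix (Fin N) (Fin N) (UgN G)⟦X⟧ :=
  genMatrix fun i j r => 2 * (shiftF G ^ (r : ℕ)) i j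

end Evaluation

end ReflectionAlgebra

end

/-!
Write `M = F - N/4`, so that `S(u) = (u + M) (u - M)⁻¹ = 2u (u - M)⁻¹ - 1`, and put `a = M₁`,
`b = M₂`. Multiplying the reflection equation by `v - b` on both sides removes the denominator of
`S₂(v)`; its two sides then differ by a combination of sandwiches of the resolvent `(u - a)⁻¹` and
of `1`. The commutation relations of `𝔤_N` say exactly that `a` commutes with `c = b - P + Q`,
hence so does the resolvent. On the other hand `(v - b) R(u - v)` and `R(u + v) (v + b)` differ from
`v - c` and `v + c` only by terms which contain the factor `u - a` or `Q`; the former cancel the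
resolvent, and the latter are simplified by `(a + b) Q = -(N/2) Q = Q (a + b)`. What remains and
contains the resolvent is even in `v`, so it drops out of the difference of the two sides, and the
rest is an identity between rational functions.
-/

noncomputable section

namespace ReflectionAlgebra

section Abstract

/-- The relations between `P`, `Q` and the two copies `a = M₁`, `b = M₂` of a matrix `M` which make
the Cayley transform `(u + M) (u - M)⁻¹` a solution of the reflection equation. In the application
`M = F - N/4`, the sign `ε` is that of `Gᵗ = ε G`, and `κ + ε = N/2`. -/
structure IsReflectionQuadruple {K M : Type*} [CommRing K] [Ring M] [Algebra K M] (κ ε : K)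
    (P Q a b : M) : Prop where
  P_mul_P : P * P = 1
  P_mul_Q : P * Q = ε • Q
  Q_mul_P : Q * P = ε • Q
  Q_mul_Q : Q * Q = (2 * (κ + ε)) • Q
  P_mul_a : P * a = b * P
  add_mul_Q : (a + b) * Q = -(κ + ε) • Q
  Q_mul_add : Q * (a + b) = -(κ + ε) • Q
  commute : Commute a (b - P + Q)

/-- The `R`-matrix `1 - P/z + Q/(z - κ)`, with `α` and `β` standing for `1/z` and
`1/(z - κ)`. -/
def rMatrix {K M : Type*} [CommRing K] [Ring M] [Algebra K M] (P Q : M) (α β : K) : M :=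
  1 - α • P + β • Q

theorem commute_smul_one_sub_add {K M : Type*} [CommRing K] [Ring M] [Algebra K M] (v : K)
    (m : M) : Commute (v • 1 - m) (v • 1 + m) := by
  have hv : Commute (v • 1) m := (Commute.one_left m).smul_left v
  exact ((Commute.refl _).add_right hv).sub_left (hv.symm.add_right (Commute.refl m))

namespace IsReflectionQuadruple

variable {K M : Type*} [CommRing K] [Ring M] [Algebra K M] {κ ε : K} {P Q a b : M}

theorem map {L M' : Type*} [CommRing L] [Ring M'] [Algebra L M'] {σ : K →+* L}
    (h : IsReflectionQuadruple κ ε P Q a b) (f : M →+* M') (hf : ∀ k m, f (k • m) = σ k • f m) :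
    IsReflectionQuadruple (σ κ) (σ ε) (f P) (f Q) (f a) (f b) where
  P_mul_P := by rw [← map_mul, h.P_mul_P, map_one]
  P_mul_Q := by rw [← map_mul, h.P_mul_Q, hf]
  Q_mul_P := by rw [← map_mul, h.Q_mul_P, hf]
  Q_mul_Q := by rw [← map_mul, h.Q_mul_Q, hf, map_mul, map_add, map_ofNat]
  P_mul_a := by rw [← map_mul, h.P_mul_a, map_mul]
  add_mul_Q := by rw [← map_add, ← map_mul, h.add_mul_Q, hf, map_neg, map_add]
  Q_mul_add := by rw [← map_add, ← map_mul, h.Q_mul_add, hf, map_neg, map_add]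
  commute := by simpa only [map_sub, map_add] using h.commute.map f

theorem P_mul_b (h : IsReflectionQuadruple κ ε P Q a b) : P * b = a * P := by
  calc P * b = P * (b * P) * P := by rw [mul_assoc, mul_assoc, h.P_mul_P, mul_one]
    _ = a * P := by rw [← h.P_mul_a, ← mul_assoc, h.P_mul_P, one_mul]

theorem commutant_mul_Q (h : IsReflectionQuadruple κ ε P Q a b) :
    (b - P + Q) * Q = (κ • 1 - a) * Q := by
  have := h.add_mul_Q
  simp only [add_mul, sub_mul, h.P_mul_Q, h.Q_mul_Q, smul_mul_assoc, one_mul] at this ⊢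
  linear_combination (norm := module) this

theorem Q_mul_commutant (h : IsReflectionQuadruple κ ε P Q a b) :
    Q * (b - P + Q) = Q * (κ • 1 - a) := by
  have := h.Q_mul_add
  simp only [mul_add, mul_sub, h.Q_mul_P, h.Q_mul_Q, mul_smul_comm, mul_one] at this ⊢
  linear_combination (norm := module) this

theorem rMatrix_mul_rMatrix (h : IsReflectionQuadruple κ ε P Q a b) (α β α' β' : K) :
    rMatrix P Q α β * rMatrix P Q α' β' = (1 + α * α') • 1 - (α + α') • P +
      (β + β' - ε * (α * β' + α' * β) + 2 * (κ + ε) * (β * β')) • Q := by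
  simp only [rMatrix, mul_add, add_mul, mul_sub, sub_mul, smul_mul_assoc, mul_smul_comm, mul_one,
    one_mul, h.P_mul_P, h.P_mul_Q, h.Q_mul_P, h.Q_mul_Q]
  module

variable {u v α β α' β' : K}

theorem rMatrix_mul_sub (h : IsReflectionQuadruple κ ε P Q a b) (hα : α * (u - v) = 1)
    (hβ : β * (u - v - κ) = 1) :
    rMatrix P Q α β * (v • 1 - b) =
      (v • 1 - (b - P + Q)) - α • ((u • 1 - a) * P) - β • (Q * (b - (u - κ) • 1)) := by
  simp only [rMatrix, add_mul, mul_sub, sub_mul, smul_mul_assoc, mul_smul_comm, mul_one,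
    one_mul, h.P_mul_b]
  linear_combination (norm := module) hα • P - hβ • Q

theorem sub_mul_rMatrix (h : IsReflectionQuadruple κ ε P Q a b) (hα : α * (u - v) = 1)
    (hβ : β * (u - v - κ) = 1) :
    (v • 1 - b) * rMatrix P Q α β =
      (v • 1 - (b - P + Q)) - α • (P * (u • 1 - a)) - β • ((b - (u - κ) • 1) * Q) := by
  simp only [rMatrix, mul_add, mul_sub, sub_mul, smul_mul_assoc, mul_smul_comm, mul_one,
    one_mul, h.P_mul_a]
  linear_combination (norm := module) hα • P - hβ • Q

theorem rMatrix_mul_add (h : IsReflectionQuadruple κ ε P Q a b) (hα : α * (u + v) = 1)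
    (hβ : β * (u + v - κ) = 1) :
    rMatrix P Q α β * (v • 1 + b) =
      (v • 1 + (b - P + Q)) + α • ((u • 1 - a) * P) + β • (Q * (b - (u - κ) • 1)) := by
  have := h.rMatrix_mul_sub (v := -v) (by rwa [sub_neg_eq_add]) (by rwa [sub_neg_eq_add])
  rw [show (v • 1 + b : M) = -(-v • 1 - b) by module, mul_neg, this]
  module

section Resolvent

variable {x : Mˣ}

theorem commute_inv (h : IsReflectionQuadruple κ ε P Q a b) (hx : (x : M) = u • 1 - a) :
    Commute (↑x⁻¹ : M) (b - P + Q) := by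
  refine Commute.units_inv_left ?_
  rw [hx]
  exact ((Commute.one_left _).smul_left u).sub_left h.commute

theorem sub_mul_inv_mul_Q (h : IsReflectionQuadruple κ ε P Q a b) (hx : (x : M) = u • 1 - a)
    (hβ : β * (u + v - κ) = 1) :
    β • ((v • 1 - (b - P + Q)) * ↑x⁻¹ * Q) = ↑x⁻¹ * Q - β • Q := by
  have key : (↑x⁻¹ : M) * (b - P + Q) * Q = Q - (u - κ) • (↑x⁻¹ * Q) := by
    rw [mul_assoc, h.commutant_mul_Q, show κ • 1 - a = ↑x - (u - κ) • 1 by rw [hx]; module,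
      sub_mul, mul_sub, Units.inv_mul_cancel_left, smul_mul_assoc, one_mul, mul_smul_comm]
  rw [sub_mul, ← (h.commute_inv hx).eq, sub_mul, key, smul_mul_assoc, one_mul, smul_mul_assoc]
  linear_combination (norm := module) hβ • (↑x⁻¹ * Q)

theorem Q_mul_inv_mul_add (h : IsReflectionQuadruple κ ε P Q a b) (hx : (x : M) = u • 1 - a)
    (hβ : β * (u - v - κ) = 1) :
    β • (Q * (↑x⁻¹ * (v • 1 + (b - P + Q)))) = β • Q - Q * ↑x⁻¹ := by
  have key : Q * ((b - P + Q) * ↑x⁻¹) = Q - (u - κ) • (Q * ↑x⁻¹) := by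
    rw [← mul_assoc, h.Q_mul_commutant, show κ • 1 - a = ↑x - (u - κ) • 1 by rw [hx]; module,
      mul_sub, sub_mul, Units.mul_inv_cancel_right, mul_smul_comm, mul_one, smul_mul_assoc]
  rw [mul_add, (h.commute_inv hx).eq, mul_add, key, mul_smul_comm, mul_one, mul_smul_comm]
  linear_combination (norm := module) -hβ • (Q * ↑x⁻¹)

theorem sandwich_eq (h : IsReflectionQuadruple κ ε P Q a b) (hx : (x : M) = u • 1 - a)
    (hα : α * (u - v) = 1) (hα' : α' * (u + v) = 1)
    (hβ : β * (u - v - κ) = 1) (hβ' : β' * (u + v - κ) = 1) :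
    (v • 1 - b) * rMatrix P Q α β * ↑x⁻¹ * (rMatrix P Q α' β' * (v • 1 + b)) =
      (v • 1 - (b - P + Q)) * ↑x⁻¹ * (v • 1 + (b - P + Q))
      + α' • ((v • 1 - (b - P + Q)) * P) - α • (P * (v • 1 + (b - P + Q)))
      - (α * α') • (P * (x : M) * P)
      + ↑x⁻¹ * Q * (b - (u - κ) • 1) + (b - (u - κ) • 1) * Q * ↑x⁻¹
      - (β' + ε * α * β') • (Q * (b - (u - κ) • 1))
      - (β + ε * α' * β) • ((b - (u - κ) • 1) * Q)
      - (β * β') • ((b - (u - κ) • 1) * Q * ↑x⁻¹ * Q * (b - (u - κ) • 1)) := by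
  have hQ := congrArg (· * (b - (u - κ) • 1)) (h.sub_mul_inv_mul_Q hx hβ')
  have hQ' := congrArg ((b - (u - κ) • 1) * ·) (h.Q_mul_inv_mul_add hx hβ)
  have hPQ : P * (Q * (b - (u - κ) • 1)) = ε • (Q * (b - (u - κ) • 1)) := by
    rw [← mul_assoc, h.P_mul_Q, smul_mul_assoc]
  rw [h.sub_mul_rMatrix hα hβ, h.rMatrix_mul_add hα' hβ', ← hx]
  generalize b - (u - κ) • (1 : M) = q, v • 1 - (b - P + Q) = V, v • 1 + (b - P + Q) = V' at *
  simp only [sub_mul, mul_add, smul_mul_assoc, mul_smul_comm, mul_sub, mul_assoc,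
    Units.inv_mul_cancel_left, Units.mul_inv_cancel_left, hPQ, h.Q_mul_P] at hQ hQ' ⊢
  linear_combination (norm := module) hQ - hQ'

theorem sandwich_sub_sandwich (h : IsReflectionQuadruple κ ε P Q a b)
    (hx : (x : M) = u • 1 - a) (hα : α * (u - v) = 1) (hα' : α' * (u + v) = 1)
    (hβ : β * (u - v - κ) = 1) (hβ' : β' * (u + v - κ) = 1) :
    (v • 1 - b) * rMatrix P Q α β * ↑x⁻¹ * (rMatrix P Q α' β' * (v • 1 + b))
        - (v • 1 + b) * rMatrix P Q α' β' * ↑x⁻¹ * (rMatrix P Q α β * (v • 1 - b)) =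
      (α - α') • (b * P - P * b) + (β - β' - ε * (α * β' - α' * β)) • (Q * b - b * Q) := by
  -- Replacing `v` by `-v` exchanges the two sandwiches.
  have hneg := h.sandwich_eq (v := -v) hx (α := α') (α' := α) (β := β') (β' := β)
    (by linear_combination hα') (by linear_combination hα)
    (by linear_combination hβ') (by linear_combination hβ)
  have hcomm : (v • 1 - (b - P + Q)) * ↑x⁻¹ * (v • 1 + (b - P + Q)) =
      (v • 1 + (b - P + Q)) * ↑x⁻¹ * (v • 1 - (b - P + Q)) := by
    have hv : Commute (↑x⁻¹ : M) (v • 1) := (Commute.one_right _).smul_right v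
    rw [← (hv.sub_right (h.commute_inv hx)).eq, ← (hv.add_right (h.commute_inv hx)).eq, mul_assoc,
      (commute_smul_one_sub_add v _).eq, mul_assoc]
  have e : ∀ y : M, -v • 1 - y = -(v • 1 + y) ∧ -v • 1 + y = -(v • 1 - y) :=
    fun y => ⟨by module, by module⟩
  simp only [(e _).1, (e _).2, neg_mul, mul_neg, neg_neg] at hneg
  rw [h.sandwich_eq hx hα hα' hβ hβ', hneg, hcomm]
  simp only [mul_add, add_mul, mul_sub Q, mul_sub P, sub_mul _ _ P, sub_mul _ _ Q,
    smul_mul_assoc, mul_smul_comm, one_mul, mul_one, h.P_mul_Q, h.Q_mul_P]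
  module

theorem smul_sandwich_sub_sandwich (h : IsReflectionQuadruple κ ε P Q a b)
    (hx : (x : M) = u • 1 - a) (hα : α * (u - v) = 1) (hα' : α' * (u + v) = 1)
    (hβ : β * (u - v - κ) = 1) (hβ' : β' * (u + v - κ) = 1) :
    u • ((v • 1 - b) * rMatrix P Q α β * ↑x⁻¹ * (rMatrix P Q α' β' * (v • 1 + b))
        - (v • 1 + b) * rMatrix P Q α' β' * ↑x⁻¹ * (rMatrix P Q α β * (v • 1 - b))) =
      v • (rMatrix P Q α β * rMatrix P Q α' β' * b
        - b * (rMatrix P Q α β * rMatrix P Q α' β')) := by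
  have hα₂ : u * (α - α') = v * (α + α') := by linear_combination hα - hα'
  have hβ₂ : u * (β - β' - ε * (α * β' - α' * β)) =
      v * (β + β' - ε * (α * β' + α' * β) + 2 * (κ + ε) * (β * β')) := by
    linear_combination hβ - hβ' - ε * β' * hα + ε * β * hα' + (κ + ε) * (β' * hβ - β * hβ')
  rw [h.sandwich_sub_sandwich hx hα hα' hβ hβ', h.rMatrix_mul_rMatrix]
  simp only [mul_add, add_mul, mul_sub b, sub_mul, smul_mul_assoc, mul_smul_comm, one_mul, mul_one]
  linear_combination (norm := module) hα₂ • (b * P - P * b) + hβ₂ • (Q * b - b * Q)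

end Resolvent

theorem rMatrix_commute (h : IsReflectionQuadruple κ ε P Q a b) (α β α' β' : K) :
    Commute (rMatrix P Q α β) (rMatrix P Q α' β') := by
  rw [Commute, SemiconjBy, h.rMatrix_mul_rMatrix, h.rMatrix_mul_rMatrix]
  module

theorem product_sub_product (h : IsReflectionQuadruple κ ε P Q a b) (v α β α' β' : K) :
    (v • 1 - b) * rMatrix P Q α β * (rMatrix P Q α' β' * (v • 1 + b))
        - (v • 1 + b) * rMatrix P Q α' β' * (rMatrix P Q α β * (v • 1 - b)) =
      (2 * v) • (rMatrix P Q α β * rMatrix P Q α' β' * b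
        - b * (rMatrix P Q α β * rMatrix P Q α' β')) := by
  have hAB := (h.rMatrix_commute α β α' β').eq
  generalize rMatrix P Q α β = A, rMatrix P Q α' β' = B at *
  rw [mul_assoc _ A (B * _), ← mul_assoc A, mul_assoc _ B (A * _), ← mul_assoc B, ← hAB]
  simp only [mul_add, mul_sub, sub_mul, add_mul, smul_mul_assoc, mul_smul_comm, one_mul, mul_one,
    mul_assoc]
  module

theorem reflection_equation (h : IsReflectionQuadruple κ ε P Q a b) {S₁ S₂ : M}
    (hα : α * (u - v) = 1) (hα' : α' * (u + v) = 1)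
    (hβ : β * (u - v - κ) = 1) (hβ' : β' * (u + v - κ) = 1)
    (ha : IsUnit (u • 1 - a)) (hb : IsUnit (v • 1 - b))
    (hS₁ : S₁ * (u • 1 - a) = u • 1 + a) (hS₂ : S₂ * (v • 1 - b) = v • 1 + b) :
    rMatrix P Q α β * S₁ * rMatrix P Q α' β' * S₂ =
      S₂ * rMatrix P Q α' β' * S₁ * rMatrix P Q α β := by
  obtain ⟨x, hx⟩ := ha
  obtain ⟨y, hy⟩ := hb
  have hS₁' : S₁ = (2 * u) • ↑x⁻¹ - 1 := by
    rw [← hx, ← Units.eq_mul_inv_iff_mul_eq] at hS₁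
    rw [hS₁, show u • 1 + a = (2 * u) • 1 - ↑x by rw [hx]; module, sub_mul, Units.mul_inv,
      smul_mul_assoc, one_mul]
  have hS₂' : (v • 1 - b) * S₂ = v • 1 + b := by
    rw [← hy, ← Units.eq_mul_inv_iff_mul_eq] at hS₂
    rw [hS₂, ← mul_assoc, (commute_smul_one_sub_add v b).eq, ← hy, Units.mul_inv_cancel_right]
  refine y.isUnit.mul_left_cancel (y.isUnit.mul_right_cancel ?_)
  rw [hy]
  calc (v • 1 - b) * (rMatrix P Q α β * S₁ * rMatrix P Q α' β' * S₂) * (v • 1 - b)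
    _ = (v • 1 - b) * rMatrix P Q α β * S₁ * (rMatrix P Q α' β' * (v • 1 + b)) := by
      rw [← hS₂]; simp only [mul_assoc]
    _ = (v • 1 + b) * rMatrix P Q α' β' * S₁ * (rMatrix P Q α β * (v • 1 - b)) := by
      have expand (L R : M) : L * S₁ * R = (2 * u) • (L * ↑x⁻¹ * R) - L * R := by
        simp only [hS₁', mul_sub, sub_mul, mul_smul_comm, smul_mul_assoc, mul_one]
      rw [expand, expand]
      linear_combination (norm := module)
        (2 : K) • h.smul_sandwich_sub_sandwich hx hα hα' hβ hβ' - h.product_sub_product v α β α' β'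
    _ = (v • 1 - b) * (S₂ * rMatrix P Q α' β' * S₁ * rMatrix P Q α β) * (v • 1 - b) := by
      rw [← hS₂']; simp only [mul_assoc]

end IsReflectionQuadruple

end Abstract

section Kronecker

variable {R A m n : Type*} [CommSemiring R] [Semiring A] [Algebra R A] [Fintype m] [Fintype n]

theorem kronecker_one_mul_map_apply [DecidableEq n] (T : Matrix m m A)
    (C : Matrix (m × n) (m × n) R) (i j : m) (k l : n) :
    ((T ⊗ₖ (1 : Matrix n n A)) * C.map (algebraMap R A)) (i, k) (j, l) =
      ∑ p, C (p, k) (j, l) • T i p := by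
  simp only [Matrix.mul_apply, Fintype.sum_prod_type, Matrix.kroneckerMap_apply, Matrix.one_apply,
    Matrix.map_apply, mul_ite, mul_one, mul_zero, ← Algebra.commutes, ← Algebra.smul_def,
    Finset.sum_ite_eq, Finset.mem_univ, if_true]

theorem map_mul_kronecker_one_apply [DecidableEq n] (T : Matrix m m A)
    (C : Matrix (m × n) (m × n) R) (i j : m) (k l : n) :
    (C.map (algebraMap R A) * (T ⊗ₖ (1 : Matrix n n A))) (i, k) (j, l) =
      ∑ p, C (i, k) (p, l) • T p j := by
  simp only [Matrix.mul_apply, Fintype.sum_prod_type, Matrix.kroneckerMap_apply, Matrix.one_apply,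
    Matrix.map_apply, mul_ite, mul_one, mul_zero, Finset.sum_ite_eq',
    Finset.mem_univ, if_true, ← Algebra.smul_def]

theorem one_kronecker_mul_map_apply [DecidableEq m] (T : Matrix n n A)
    (C : Matrix (m × n) (m × n) R) (i j : m) (k l : n) :
    (((1 : Matrix m m A) ⊗ₖ T) * C.map (algebraMap R A)) (i, k) (j, l) =
      ∑ p, C (i, p) (j, l) • T k p := by
  simp only [Matrix.mul_apply, Fintype.sum_prod_type_right, Matrix.kroneckerMap_apply,
    Matrix.one_apply, Matrix.map_apply, ite_mul, one_mul, zero_mul, ← Algebra.commutes,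
    ← Algebra.smul_def, smul_ite, smul_zero, Finset.sum_ite_eq, Finset.mem_univ, if_true]

theorem map_mul_one_kronecker_apply [DecidableEq m] (T : Matrix n n A)
    (C : Matrix (m × n) (m × n) R) (i j : m) (k l : n) :
    (C.map (algebraMap R A) * ((1 : Matrix m m A) ⊗ₖ T)) (i, k) (j, l) =
      ∑ p, C (i, k) (j, p) • T p l := by
  simp only [Matrix.mul_apply, Fintype.sum_prod_type_right, Matrix.kroneckerMap_apply,
    Matrix.one_apply, Matrix.map_apply, ite_mul, one_mul, zero_mul, mul_ite, mul_zero,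
    Finset.sum_ite_eq', Finset.mem_univ, if_true, ← Algebra.smul_def]

end Kronecker

section FormAdjoint

variable {n R : Type*} [Fintype n] [DecidableEq n] [CommRing R] {G : Matrix n n R}

/-- The map `M ↦ G⁻¹ Mᵀ G`, which takes `M` to its adjoint for the bilinear form of `G`. -/
def formAdjoint (G : Matrix n n R) : Matrix n n R →ₗ[R] Matrix n n R where
  toFun M := G⁻¹ * Mᵀ * G
  map_add' A B := by rw [Matrix.transpose_add, mul_add, add_mul]
  map_smul' c A := by rw [Matrix.transpose_smul, Matrix.mul_smul, Matrix.smul_mul, RingHom.id_apply]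

theorem formAdjoint_apply (G M : Matrix n n R) : formAdjoint G M = G⁻¹ * Mᵀ * G := rfl

theorem formAdjoint_mul (hdet : IsUnit G.det) (A B : Matrix n n R) :
    formAdjoint G (A * B) = formAdjoint G B * formAdjoint G A := by
  simp only [formAdjoint_apply, Matrix.transpose_mul, mul_assoc,
    Matrix.mul_nonsing_inv_cancel_left _ _ hdet]

theorem transpose_inv_eq_smul (hdet : IsUnit G.det) {ε : R} (hε : ε * ε = 1) (hG : Gᵀ = ε • G) :
    G⁻¹ᵀ = ε • G⁻¹ := by
  rw [Matrix.transpose_nonsing_inv, hG]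
  refine Matrix.inv_eq_left_inv ?_
  rw [Matrix.smul_mul, Matrix.mul_smul, smul_smul, hε, Matrix.nonsing_inv_mul G hdet, one_smul]

theorem formAdjoint_formAdjoint (hdet : IsUnit G.det) {ε : R} (hε : ε * ε = 1) (hG : Gᵀ = ε • G)
    (M : Matrix n n R) : formAdjoint G (formAdjoint G M) = M := by
  simp only [formAdjoint_apply, Matrix.transpose_mul, Matrix.transpose_transpose, hG,
    transpose_inv_eq_smul hdet hε hG, Matrix.mul_smul, Matrix.smul_mul, smul_smul, hε, one_smul,
    mul_assoc, Matrix.nonsing_inv_mul G hdet, mul_one, Matrix.nonsing_inv_mul_cancel_left _ _ hdet]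

/-- The map `M ↦ M - G⁻¹ Mᵀ G`, which takes `E_ij` to `F_ij`. Its values are skew-adjoint for the
bilinear form of `G` when `Gᵗ = ±G`. -/
def skewProj (G : Matrix n n R) : Matrix n n R →ₗ[R] Matrix n n R :=
  LinearMap.id - formAdjoint G

theorem skewProj_apply (G M : Matrix n n R) : skewProj G M = M - formAdjoint G M := rfl

theorem skewProj_formAdjoint (hdet : IsUnit G.det) {ε : R} (hε : ε * ε = 1) (hG : Gᵀ = ε • G)
    (M : Matrix n n R) : skewProj G (formAdjoint G M) = -skewProj G M := by
  rw [skewProj_apply, skewProj_apply, formAdjoint_formAdjoint hdet hε hG, neg_sub]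

theorem skewProj_commutator (hdet : IsUnit G.det) {ε : R} (hε : ε * ε = 1) (hG : Gᵀ = ε • G)
    (A B : Matrix n n R) :
    skewProj G A * skewProj G B - skewProj G B * skewProj G A =
      skewProj G (A * skewProj G B - skewProj G B * A) := by
  simp only [skewProj_apply, mul_sub, sub_mul, map_sub, formAdjoint_mul hdet,
    formAdjoint_formAdjoint hdet hε hG]
  abel

theorem formAdjoint_single_apply (G : Matrix n n R) (i j a b : n) :
    formAdjoint G (Matrix.single i j 1) a b = G i b * G⁻¹ a j := by
  simp [formAdjoint_apply, Matrix.mul_apply, Matrix.single_apply, ite_and, mul_comm]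

end FormAdjoint

section Operators

variable {N : ℕ}

theorem opP_apply (i k j l : Fin N) :
    opP N (i, k) (j, l) = if i = l ∧ k = j then 1 else 0 := by
  simp only [opP, Matrix.sum_apply, Matrix.kroneckerMap_apply, Matrix.single_apply, ite_and,
    mul_ite, mul_one, mul_zero]
  simp [eq_comm]

theorem opPt_apply (i k j l : Fin N) :
    opPt N (i, k) (j, l) = if i = k ∧ j = l then 1 else 0 := by
  simp only [opPt, Matrix.sum_apply, Matrix.kroneckerMap_apply, Matrix.single_apply, ite_and,
    mul_ite, mul_one, mul_zero]
  simp [eq_comm]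

theorem opPt_mul_opPt (N : ℕ) : opPt N * opPt N = (N : ℂ) • opPt N := by
  ext ⟨i, k⟩ ⟨j, l⟩
  simp only [Matrix.mul_apply, Fintype.sum_prod_type, opPt_apply, ite_and, mul_ite, mul_one,
    mul_zero, Matrix.smul_apply, smul_eq_mul]
  split_ifs <;> simp [*]

theorem opQ_apply (G : Matrix (Fin N) (Fin N) ℂ) (i k j l : Fin N) :
    opQ G (i, k) (j, l) = G i k * G⁻¹ l j := by
  simp [opQ, Matrix.mul_apply, Fintype.sum_prod_type, opPt_apply, Matrix.one_apply, ite_and]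

theorem opP_mul_apply (M : Matrix (Fin N × Fin N) (Fin N × Fin N) ℂ) (i k : Fin N)
    (p : Fin N × Fin N) : (opP N * M) (i, k) p = M (k, i) p := by
  simp [Matrix.mul_apply, Fintype.sum_prod_type, opP_apply, ite_and]

theorem mul_opP_apply (M : Matrix (Fin N × Fin N) (Fin N × Fin N) ℂ) (j l : Fin N)
    (p : Fin N × Fin N) : (M * opP N) p (j, l) = M p (l, j) := by
  simp [Matrix.mul_apply, Fintype.sum_prod_type, opP_apply, ite_and]

theorem opP_mul_opP (N : ℕ) : opP N * opP N = 1 := by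
  ext ⟨i, k⟩ ⟨j, l⟩
  simp [opP_mul_apply, opP_apply, Matrix.one_apply, and_comm]

variable {G : Matrix (Fin N) (Fin N) ℂ} {ε : ℂ}

theorem opP_mul_opQ (hG : Gᵀ = ε • G) : opP N * opQ G = ε • opQ G := by
  ext ⟨i, k⟩ ⟨j, l⟩
  have : G k i = ε * G i k := congrFun₂ hG i k
  rw [opP_mul_apply, Matrix.smul_apply, opQ_apply, opQ_apply, this, smul_eq_mul, mul_assoc]

theorem opQ_mul_opP (hdet : IsUnit G.det) (hε : ε * ε = 1) (hG : Gᵀ = ε • G) :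
    opQ G * opP N = ε • opQ G := by
  ext ⟨i, k⟩ ⟨j, l⟩
  have : G⁻¹ j l = ε * G⁻¹ l j := congrFun₂ (transpose_inv_eq_smul hdet hε hG) l j
  rw [mul_opP_apply, Matrix.smul_apply, opQ_apply, opQ_apply, this, smul_eq_mul]
  ring

theorem opQ_swap (hdet : IsUnit G.det) (hε : ε * ε = 1) (hG : Gᵀ = ε • G) (i k j l : Fin N) :
    opQ G (k, i) (l, j) = opQ G (i, k) (j, l) := by
  rw [← opP_mul_apply (opQ G), ← mul_opP_apply (opP N * opQ G), opP_mul_opQ hG, Matrix.smul_mul,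
    opQ_mul_opP hdet hε hG, smul_smul, hε, one_smul]

theorem opQ_mul_opQ (hdet : IsUnit G.det) : opQ G * opQ G = (N : ℂ) • opQ G := by
  have hG : (G⁻¹ ⊗ₖ (1 : Matrix (Fin N) (Fin N) ℂ)) * (G ⊗ₖ 1) = 1 := by
    rw [← Matrix.mul_kronecker_mul, Matrix.nonsing_inv_mul G hdet, one_mul,
      Matrix.one_kronecker_one]
  calc opQ G * opQ G
    _ = (G ⊗ₖ 1) * (opPt N * ((G⁻¹ ⊗ₖ 1) * (G ⊗ₖ 1)) * opPt N) * (G⁻¹ ⊗ₖ 1) := by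
      simp only [opQ, Matrix.mul_assoc]
    _ = (N : ℂ) • opQ G := by
      rw [hG, mul_one, opPt_mul_opPt, Matrix.mul_smul, Matrix.smul_mul, opQ]

end Operators

section SingleSum

variable {n R : Type*} [Fintype n] [DecidableEq n] [Semiring R]

theorem single_mul_eq_sum (i j : n) (M : Matrix n n R) :
    Matrix.single i j 1 * M = ∑ p, M j p • Matrix.single i p 1 := by
  ext a b
  simp [Matrix.mul_apply, Matrix.sum_apply, Matrix.single_apply, ite_and]

theorem mul_single_eq_sum (i j : n) (M : Matrix n n R) :
    M * Matrix.single i j 1 = ∑ p, M p i • Matrix.single p j 1 := by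
  ext a b
  simp [Matrix.mul_apply, Matrix.sum_apply, Matrix.single_apply, ite_and]

end SingleSum

section Commutation

attribute [local instance 100] LieRing.ofAssociativeRing

variable {N : ℕ} {G : Matrix (Fin N) (Fin N) ℂ} {ε : ℂ}

theorem skewProj_mem_gN (G M : Matrix (Fin N) (Fin N) ℂ) : skewProj G M ∈ gN G := by
  rw [Matrix.matrix_eq_sum_single M, map_sum]
  refine sum_mem fun i _ => ?_
  rw [map_sum]
  refine sum_mem fun j _ => ?_
  rw [← mul_one (M i j), ← smul_eq_mul, ← Matrix.smul_single, map_smul, skewProj_apply,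
    formAdjoint_apply, ← lieF_eq]
  exact (gN G).smul_mem _ (lieF_mem_gN G i j)

/-- The linear map `𝔤𝔩_N → U(𝔤_N)` with `E_ij ↦ F_ij`. -/
def genMap (G : Matrix (Fin N) (Fin N) ℂ) : Matrix (Fin N) (Fin N) ℂ →ₗ[ℂ] UgN G :=
  (UniversalEnvelopingAlgebra.ι ℂ : gN G →ₗ⁅ℂ⁆ UgN G).toLinearMap ∘ₗ
    (skewProj G).codRestrict (gN G).toSubmodule (skewProj_mem_gN G)

theorem genMap_apply (G M : Matrix (Fin N) (Fin N) ℂ) :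
    genMap G M = UniversalEnvelopingAlgebra.ι ℂ (⟨skewProj G M, skewProj_mem_gN G M⟩ : gN G) :=
  rfl

theorem genMap_single (G : Matrix (Fin N) (Fin N) ℂ) (i j : Fin N) :
    genMap G (Matrix.single i j 1) = matF G i j := by
  rw [genMap_apply, matF, Matrix.of_apply]
  congr
  exact (lieF_eq G i j).symm

theorem genMap_formAdjoint (hdet : IsUnit G.det) (hε : ε * ε = 1) (hG : Gᵀ = ε • G)
    (M : Matrix (Fin N) (Fin N) ℂ) : genMap G (formAdjoint G M) = -genMap G M := by
  rw [genMap_apply, genMap_apply, ← map_neg]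
  congr
  exact skewProj_formAdjoint hdet hε hG M

theorem genMap_commutator (hdet : IsUnit G.det) (hε : ε * ε = 1) (hG : Gᵀ = ε • G)
    (A B : Matrix (Fin N) (Fin N) ℂ) :
    genMap G A * genMap G B - genMap G B * genMap G A =
      genMap G (A * skewProj G B - skewProj G B * A) := by
  rw [genMap_apply, genMap_apply, genMap_apply, ← LieRing.of_associative_ring_bracket,
    ← LieHom.map_lie]
  congr 1
  exact Subtype.ext (skewProj_commutator hdet hε hG A B)

theorem sum_smul_matF {ι : Type*} (s : Finset ι) (c : ι → ℂ) (i j : ι → Fin N) :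
    ∑ p ∈ s, c p • matF G (i p) (j p) =
      genMap G (∑ p ∈ s, c p • Matrix.single (i p) (j p) 1) := by
  simp only [map_sum, map_smul, genMap_single]

theorem formAdjoint_sum_opQ_left (hdet : IsUnit G.det) (i k j l : Fin N) :
    formAdjoint G (∑ p, opQ G (i, k) (p, l) • Matrix.single p j 1) =
      ∑ p, opQ G (i, k) (j, p) • Matrix.single p l 1 := by
  ext a b
  have h : ∑ p, G⁻¹ l p * G p b = (1 : Matrix (Fin N) (Fin N) ℂ) l b := by
    rw [← Matrix.mul_apply, Matrix.nonsing_inv_mul G hdet]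
  calc formAdjoint G (∑ p, opQ G (i, k) (p, l) • Matrix.single p j 1) a b
    _ = G i k * G⁻¹ a j * ∑ p, G⁻¹ l p * G p b := by
      simp only [map_sum, map_smul, Matrix.sum_apply, Matrix.smul_apply, formAdjoint_single_apply,
        opQ_apply, smul_eq_mul, Finset.mul_sum]
      exact Finset.sum_congr rfl fun p _ => by ring
    _ = _ := by
      rw [h]
      simp [Matrix.sum_apply, Matrix.single_apply, Matrix.one_apply, opQ_apply, ite_and]

theorem formAdjoint_sum_opQ_right (hdet : IsUnit G.det) (i k j l : Fin N) :
    formAdjoint G (∑ p, opQ G (p, k) (j, l) • Matrix.single i p 1) =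
      ∑ p, opQ G (i, p) (j, l) • Matrix.single k p 1 := by
  ext a b
  have h : ∑ p, G⁻¹ a p * G p k = (1 : Matrix (Fin N) (Fin N) ℂ) a k := by
    rw [← Matrix.mul_apply, Matrix.nonsing_inv_mul G hdet]
  calc formAdjoint G (∑ p, opQ G (p, k) (j, l) • Matrix.single i p 1) a b
    _ = G i b * G⁻¹ l j * ∑ p, G⁻¹ a p * G p k := by
      simp only [map_sum, map_smul, Matrix.sum_apply, Matrix.smul_apply, formAdjoint_single_apply,
        opQ_apply, smul_eq_mul, Finset.mul_sum]
      exact Finset.sum_congr rfl fun p _ => by ring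
    _ = _ := by
      rw [h]
      simp [Matrix.sum_apply, Matrix.single_apply, Matrix.one_apply, opQ_apply, ite_and, eq_comm]

theorem opQ_mul_matF_add (hdet : IsUnit G.det) (hε : ε * ε = 1) (hG : Gᵀ = ε • G) :
    (opQ G).map (algebraMap ℂ (UgN G)) * (matF G ⊗ₖ 1 + 1 ⊗ₖ matF G) = 0 := by
  ext ⟨i, k⟩ ⟨j, l⟩
  rw [mul_add, Matrix.add_apply, map_mul_kronecker_one_apply, map_mul_one_kronecker_apply,
    sum_smul_matF, sum_smul_matF, ← formAdjoint_sum_opQ_left hdet, genMap_formAdjoint hdet hε hG,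
    add_neg_cancel, Matrix.zero_apply]

theorem matF_add_mul_opQ (hdet : IsUnit G.det) (hε : ε * ε = 1) (hG : Gᵀ = ε • G) :
    (matF G ⊗ₖ 1 + 1 ⊗ₖ matF G) * (opQ G).map (algebraMap ℂ (UgN G)) = 0 := by
  ext ⟨i, k⟩ ⟨j, l⟩
  rw [add_mul, Matrix.add_apply, kronecker_one_mul_map_apply, one_kronecker_mul_map_apply,
    sum_smul_matF, sum_smul_matF, ← formAdjoint_sum_opQ_right hdet, genMap_formAdjoint hdet hε hG,
    add_neg_cancel, Matrix.zero_apply]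

theorem skewProj_single_apply (hdet : IsUnit G.det) (hε : ε * ε = 1) (hG : Gᵀ = ε • G)
    (i j a b : Fin N) :
    skewProj G (Matrix.single i j 1) a b = opP N (b, i) (a, j) - opQ G (b, i) (a, j) := by
  rw [skewProj_apply, Matrix.sub_apply, formAdjoint_single_apply, ← opQ_apply, opQ_swap hdet hε hG,
    opP_apply, Matrix.single_apply]
  simp only [and_comm, eq_comm]

theorem matF_commutator (hdet : IsUnit G.det) (hε : ε * ε = 1) (hG : Gᵀ = ε • G) :
    (matF G ⊗ₖ 1) * (1 ⊗ₖ matF G) - (1 ⊗ₖ matF G) * (matF G ⊗ₖ 1) =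
      (matF G ⊗ₖ 1) * (opP N).map (algebraMap ℂ (UgN G))
        - (opP N).map (algebraMap ℂ (UgN G)) * (matF G ⊗ₖ 1)
        - (matF G ⊗ₖ 1) * (opQ G).map (algebraMap ℂ (UgN G))
        + (opQ G).map (algebraMap ℂ (UgN G)) * (matF G ⊗ₖ 1) := by
  ext ⟨i, k⟩ ⟨j, l⟩
  simp only [Matrix.add_apply, Matrix.sub_apply, kronecker_one_mul_map_apply,
    map_mul_kronecker_one_apply, sum_smul_matF, ← map_sub, ← map_add]
  have h := genMap_commutator hdet hε hG (Matrix.single i j 1) (Matrix.single k l 1)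
  simp only [single_mul_eq_sum, mul_single_eq_sum, skewProj_single_apply hdet hε hG, sub_smul,
    Finset.sum_sub_distrib, genMap_single] at h
  convert h using 2
  · simp [Matrix.mul_apply, Fintype.sum_prod_type, Matrix.one_apply]
  · simp [Matrix.mul_apply, Fintype.sum_prod_type, Matrix.one_apply]
  · abel

end Commutation

section TensorLegs

variable {m n : Type*} [Fintype m] [Fintype n] [DecidableEq m] [DecidableEq n]

/-- The embedding `M ↦ M₁ = M ⊗ 1` into the first tensor leg. -/
def inFirst (m n R : Type*) [Fintype m] [Fintype n] [DecidableEq m] [DecidableEq n] [Ring R] :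
    Matrix m m R →+* Matrix (m × n) (m × n) R where
  toFun M := M ⊗ₖ 1
  map_one' := Matrix.one_kronecker_one
  map_zero' := Matrix.zero_kronecker _
  map_add' A B := Matrix.add_kronecker A B _
  map_mul' A B := by
    ext ⟨i, k⟩ ⟨j, l⟩
    simp [Matrix.mul_apply, Fintype.sum_prod_type, Matrix.one_apply]

/-- The embedding `M ↦ M₂ = 1 ⊗ M` into the second tensor leg. -/
def inSecond (m n R : Type*) [Fintype m] [Fintype n] [DecidableEq m] [DecidableEq n] [Ring R] :
    Matrix n n R →+* Matrix (m × n) (m × n) R where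
  toFun M := 1 ⊗ₖ M
  map_one' := Matrix.one_kronecker_one
  map_zero' := Matrix.kronecker_zero _
  map_add' A B := Matrix.kronecker_add _ A B
  map_mul' A B := by
    ext ⟨i, k⟩ ⟨j, l⟩
    simp [Matrix.mul_apply, Fintype.sum_prod_type, Matrix.one_apply]

variable {R : Type*} [Ring R]

theorem inFirst_apply (M : Matrix m m R) : inFirst m n R M = M ⊗ₖ 1 := rfl

theorem inSecond_apply (M : Matrix n n R) : inSecond m n R M = 1 ⊗ₖ M := rfl

theorem inFirst_smul_one {K : Type*} [CommRing K] [Algebra K R] (c : K) :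
    inFirst m n R (c • 1) = c • 1 := by
  rw [inFirst_apply, Matrix.smul_kronecker, Matrix.one_kronecker_one]

theorem inSecond_smul_one {K : Type*} [CommRing K] [Algebra K R] (c : K) :
    inSecond m n R (c • 1) = c • 1 := by
  rw [inSecond_apply, Matrix.kronecker_smul, Matrix.one_kronecker_one]

variable {S : Type*} [Ring S] (f : R →+* S)

theorem map_inFirst (M : Matrix m m R) :
    (inFirst m n R M).map f = inFirst m n S (M.map f) := by
  ext ⟨i, k⟩ ⟨j, l⟩
  simp [inFirst_apply, Matrix.one_apply, apply_ite f]

theorem map_inSecond (M : Matrix n n R) :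
    (inSecond m n R M).map f = inSecond m n S (M.map f) := by
  ext ⟨i, k⟩ ⟨j, l⟩
  simp [inSecond_apply, Matrix.one_apply, apply_ite f]

end TensorLegs

section Quadruple

variable {N : ℕ} {G : Matrix (Fin N) (Fin N) ℂ} {ε : ℤˣ}

theorem units_int_cast_mul_self (R : Type*) [Ring R] (ε : ℤˣ) :
    ((ε : ℤ) : R) * ((ε : ℤ) : R) = 1 := by
  exact_mod_cast congrArg (fun x : ℤ => (x : R)) (congrArg Units.val (Int.units_mul_self ε))

theorem opP_mul_inFirst {A : Type*} [Ring A] [Algebra ℂ A] (T : Matrix (Fin N) (Fin N) A) :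
    (opP N).map (algebraMap ℂ A) * inFirst _ _ A T =
      inSecond _ _ A T * (opP N).map (algebraMap ℂ A) := by
  ext ⟨i, k⟩ ⟨j, l⟩
  rw [inFirst_apply, inSecond_apply, map_mul_kronecker_one_apply, one_kronecker_mul_map_apply]
  simp [opP_apply, ite_and]

theorem inFirst_shiftF (n : Type*) [Fintype n] [DecidableEq n] (G : Matrix (Fin N) (Fin N) ℂ) :
    inFirst _ n _ (shiftF G) = matF G ⊗ₖ 1 - ((N : ℂ) / 4) • 1 := by
  rw [shiftF, map_sub, inFirst_smul_one, inFirst_apply]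

theorem inSecond_shiftF (m : Type*) [Fintype m] [DecidableEq m] (G : Matrix (Fin N) (Fin N) ℂ) :
    inSecond m _ _ (shiftF G) = 1 ⊗ₖ matF G - ((N : ℂ) / 4) • 1 := by
  rw [shiftF, map_sub, inSecond_smul_one, inSecond_apply]

theorem isReflectionQuadruple_shiftF (hdet : IsUnit G.det) (hG : Gᵀ = ((ε : ℤ) : ℂ) • G) :
    IsReflectionQuadruple (kappa N ε) ((ε : ℤ) : ℂ) ((opP N).map (algebraMap ℂ (UgN G)))
      ((opQ G).map (algebraMap ℂ (UgN G))) (inFirst _ _ _ (shiftF G))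
      (inSecond _ _ _ (shiftF G)) := by
  have hε := units_int_cast_mul_self ℂ ε
  have hκ : kappa N ε + ((ε : ℤ) : ℂ) = N / 2 := by rw [kappa]; ring
  let c := (Algebra.ofId ℂ (UgN G)).mapMatrix (m := Fin N × Fin N)
  change IsReflectionQuadruple _ _ (c (opP N)) (c (opQ G)) _ _
  have hsum : inFirst (Fin N) (Fin N) _ (shiftF G) + inSecond _ _ _ (shiftF G) =
      (matF G ⊗ₖ 1 + 1 ⊗ₖ matF G) - ((N : ℂ) / 2) • 1 := by
    rw [inFirst_shiftF, inSecond_shiftF]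
    module
  have hFQ : (matF G ⊗ₖ 1 + 1 ⊗ₖ matF G) * c (opQ G) = 0 := matF_add_mul_opQ hdet hε hG
  have hQF : c (opQ G) * (matF G ⊗ₖ 1 + 1 ⊗ₖ matF G) = 0 := opQ_mul_matF_add hdet hε hG
  refine
    { P_mul_P := by rw [← map_mul, opP_mul_opP, map_one]
      P_mul_Q := by rw [← map_mul, opP_mul_opQ hG, map_smul]
      Q_mul_P := by rw [← map_mul, opQ_mul_opP hdet hε hG, map_smul]
      Q_mul_Q := by rw [← map_mul, opQ_mul_opQ hdet, map_smul, hκ, mul_div_cancel₀ _ two_ne_zero]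
      P_mul_a := opP_mul_inFirst _
      add_mul_Q := by rw [hsum, sub_mul, hFQ, zero_sub, smul_mul_assoc, one_mul, hκ, neg_smul]
      Q_mul_add := by rw [hsum, mul_sub, hQF, zero_sub, mul_smul_comm, mul_one, hκ, neg_smul]
      commute := ?_ }
  have hFF : (matF G ⊗ₖ 1) * (1 ⊗ₖ matF G) - (1 ⊗ₖ matF G) * (matF G ⊗ₖ 1) =
      (matF G ⊗ₖ 1) * c (opP N) - c (opP N) * (matF G ⊗ₖ 1)
        - (matF G ⊗ₖ 1) * c (opQ G) + c (opQ G) * (matF G ⊗ₖ 1) := matF_commutator hdet hε hG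
  have hF : Commute (matF G ⊗ₖ 1) (1 ⊗ₖ matF G - c (opP N) + c (opQ G)) := by
    rw [Commute, SemiconjBy]
    linear_combination (norm := noncomm_ring) hFF
  rw [inFirst_shiftF, inSecond_shiftF, sub_right_comm, sub_add_eq_add_sub]
  have hc (x : Matrix (Fin N × Fin N) (Fin N × Fin N) (UgN G)) :
      Commute (((N : ℂ) / 4) • 1) x := (Commute.one_left x).smul_left _
  exact (hF.sub_right (hc _).symm).sub_left (hc _)

end Quadruple

section Cayley

theorem ext_map_coeff {m n A : Type*} [Semiring A] {S T : Matrix m n A⟦X⟧}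
    (h : ∀ r, S.map (PowerSeries.coeff r) = T.map (PowerSeries.coeff r)) : S = T := by
  ext i j r
  exact congrFun₂ (h r) i j

theorem map_coeff_one {n A : Type*} [DecidableEq n] [Semiring A] (r : ℕ) :
    (1 : Matrix n n A⟦X⟧).map (PowerSeries.coeff r) = if r = 0 then 1 else 0 := by
  ext i j
  by_cases hij : i = j <;> by_cases hr : r = 0 <;>
    simp [hij, hr, Matrix.one_apply, PowerSeries.coeff_one]

variable {n A : Type*} [Fintype n] [Ring A]

theorem map_coeff_mul_map_C (T : Matrix n n A⟦X⟧) (M : Matrix n n A) (r : ℕ) :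
    (T * M.map PowerSeries.C).map (PowerSeries.coeff r) = T.map (PowerSeries.coeff r) * M := by
  ext i j
  simp [Matrix.mul_apply]

theorem map_coeff_map_C_mul (M : Matrix n n A) (T : Matrix n n A⟦X⟧) (r : ℕ) :
    (M.map PowerSeries.C * T).map (PowerSeries.coeff r) = M * T.map (PowerSeries.coeff r) := by
  ext i j
  simp [Matrix.mul_apply]

variable [DecidableEq n]

theorem map_coeff_zero_scalar_X_mul (T : Matrix n n A⟦X⟧) :
    (Matrix.scalar n PowerSeries.X * T).map (PowerSeries.coeff 0) = 0 := by
  ext i j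
  simp

theorem map_coeff_succ_scalar_X_mul (T : Matrix n n A⟦X⟧) (r : ℕ) :
    (Matrix.scalar n PowerSeries.X * T).map (PowerSeries.coeff (r + 1)) =
      T.map (PowerSeries.coeff r) := by
  ext i j
  simp [PowerSeries.coeff_succ_X_mul]

/-- The geometric series `∑_{r ≥ 0} M^r u^{-r}`, which expands `(1 - M u⁻¹)⁻¹`; the variable `X`
stands for `u⁻¹`. -/
def geomMatrix (M : Matrix n n A) : Matrix n n A⟦X⟧ :=
  Matrix.of fun i j => PowerSeries.mk fun r => (M ^ r) i j

theorem map_coeff_geomMatrix (M : Matrix n n A) (r : ℕ) :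
    (geomMatrix M).map (PowerSeries.coeff r) = M ^ r := by
  ext i j
  simp [geomMatrix]

theorem commute_map_C_geomMatrix (M : Matrix n n A) :
    Commute (M.map PowerSeries.C) (geomMatrix M) :=
  ext_map_coeff fun r => by
    rw [map_coeff_map_C_mul, map_coeff_mul_map_C, map_coeff_geomMatrix, pow_mul_comm']

/-- The matrix `M u⁻¹`, with `X` standing for `u⁻¹`. -/
def linearMatrix (M : Matrix n n A) : Matrix n n A⟦X⟧ :=
  Matrix.scalar n PowerSeries.X * M.map PowerSeries.C

theorem linearMatrix_neg (M : Matrix n n A) : linearMatrix (-M) = -linearMatrix M := by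
  rw [linearMatrix, Matrix.map_neg _ (map_neg _), mul_neg, linearMatrix]

theorem linearMatrix_mul_geomMatrix (M : Matrix n n A) :
    linearMatrix M * geomMatrix M = geomMatrix M - 1 := by
  refine ext_map_coeff fun r => ?_
  rw [linearMatrix, mul_assoc, Matrix.map_sub _ (map_sub _), map_coeff_one, map_coeff_geomMatrix]
  cases r with
  | zero => rw [map_coeff_zero_scalar_X_mul, pow_zero, if_pos rfl, sub_self]
  | succ r =>
    rw [map_coeff_succ_scalar_X_mul, map_coeff_map_C_mul, map_coeff_geomMatrix, ← pow_succ',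
      if_neg r.succ_ne_zero, sub_zero]

theorem geomMatrix_mul_linearMatrix (M : Matrix n n A) :
    geomMatrix M * linearMatrix M = geomMatrix M - 1 := by
  have hX : Commute (Matrix.scalar n PowerSeries.X) (geomMatrix M) :=
    Matrix.scalar_commute _ (fun p => (PowerSeries.commute_X p).symm) _
  rw [← linearMatrix_mul_geomMatrix]
  exact ((hX.mul_left (commute_map_C_geomMatrix M)).eq).symm

theorem isUnit_one_sub_linearMatrix (M : Matrix n n A) : IsUnit (1 - linearMatrix M) :=
  ⟨⟨_, geomMatrix M, by rw [sub_mul, one_mul, linearMatrix_mul_geomMatrix, sub_sub_cancel],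
    by rw [mul_sub, mul_one, geomMatrix_mul_linearMatrix, sub_sub_cancel]⟩, rfl⟩

variable {N : ℕ}

/-- The expansion `1 + 2 ∑_{r ≥ 1} M^r u^{-r}` of the Cayley transform `(u + M) (u - M)⁻¹`. -/
def cayleySeries (M : Matrix (Fin N) (Fin N) A) : Matrix (Fin N) (Fin N) A⟦X⟧ :=
  genMatrix fun i j r => 2 * (M ^ (r : ℕ)) i j

theorem map_coeff_cayleySeries (M : Matrix (Fin N) (Fin N) A) (r : ℕ) :
    (cayleySeries M).map (PowerSeries.coeff r) = if r = 0 then 1 else 2 * M ^ r := by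
  ext i j
  by_cases hr : r = 0
  · simp [hr, cayleySeries, genMatrix, Matrix.one_apply]
  · simp [hr, Nat.pos_of_ne_zero hr, cayleySeries, genMatrix, two_mul]

theorem cayleySeries_eq (M : Matrix (Fin N) (Fin N) A) :
    cayleySeries M = 2 * geomMatrix M - 1 := by
  refine ext_map_coeff fun r => ?_
  rw [two_mul, Matrix.map_sub _ (map_sub _), Matrix.map_add _ (map_add _), map_coeff_geomMatrix,
    map_coeff_one, map_coeff_cayleySeries, ← two_mul]
  split_ifs with hr
  · rw [hr, pow_zero, mul_one, ← one_add_one_eq_two, add_sub_cancel_right]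
  · rw [sub_zero]

theorem cayleySeries_mul_one_sub (M : Matrix (Fin N) (Fin N) A) :
    cayleySeries M * (1 - linearMatrix M) = 1 + linearMatrix M := by
  rw [cayleySeries_eq]
  linear_combination (norm := noncomm_ring) (-2 : ℤ) • geomMatrix_mul_linearMatrix M

theorem map_negArg_cayleySeries (M : Matrix (Fin N) (Fin N) A) :
    (cayleySeries M).map negArg = cayleySeries (-M) := by
  refine ext_map_coeff fun r => ?_
  have hneg : ((cayleySeries M).map negArg).map (PowerSeries.coeff r) =
      (-1) ^ r * (cayleySeries M).map (PowerSeries.coeff r) := by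
    ext i j
    rcases r.even_or_odd with hr | hr <;> simp [negArg, hr.neg_one_pow]
  rw [hneg, map_coeff_cayleySeries, map_coeff_cayleySeries, neg_pow M]
  split_ifs with hr
  · rw [hr, pow_zero, one_mul]
  · exact ((Commute.ofNat_right ((-1) ^ r) 2).left_comm _)

theorem cayleySeries_mul_map_negArg (M : Matrix (Fin N) (Fin N) A) :
    cayleySeries M * (cayleySeries M).map negArg = 1 := by
  have hunit := isUnit_one_sub_linearMatrix (-M)
  have h := cayleySeries_mul_one_sub (-M)
  rw [linearMatrix_neg, sub_neg_eq_add] at hunit h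
  refine hunit.mul_right_cancel ?_
  rw [map_negArg_cayleySeries, mul_assoc, h, ← sub_eq_add_neg, cayleySeries_mul_one_sub, one_mul]

variable {R : Type*} [Ring R] (θ : A⟦X⟧ →+* R) {w : R} (M : Matrix (Fin N) (Fin N) A)

theorem scalar_mul_map_linearMatrix (hw : w * θ PowerSeries.X = 1) :
    Matrix.scalar (Fin N) w * θ.mapMatrix (linearMatrix M) = M.map (θ.comp PowerSeries.C) := by
  have hX : θ.mapMatrix (Matrix.scalar (Fin N) PowerSeries.X) =
      Matrix.scalar (Fin N) (θ PowerSeries.X) := by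
    simp
  rw [linearMatrix, map_mul, hX, ← mul_assoc, ← map_mul, hw, map_one, one_mul]
  rfl

theorem isUnit_scalar_sub (hw : w * θ PowerSeries.X = 1) (hc : ∀ r, Commute w r) :
    IsUnit (Matrix.scalar (Fin N) w - M.map (θ.comp PowerSeries.C)) := by
  have hunit : IsUnit w := ⟨⟨w, θ PowerSeries.X, hw, (hc _).eq ▸ hw⟩, rfl⟩
  have h := (hunit.map (Matrix.scalar (Fin N))).mul
    ((isUnit_one_sub_linearMatrix M).map θ.mapMatrix)
  rwa [map_sub, map_one, mul_sub, mul_one, scalar_mul_map_linearMatrix θ M hw] at h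

theorem map_cayleySeries_mul_scalar_sub (hw : w * θ PowerSeries.X = 1) (hc : ∀ r, Commute w r) :
    (cayleySeries M).map θ * (Matrix.scalar (Fin N) w - M.map (θ.comp PowerSeries.C)) =
      Matrix.scalar (Fin N) w + M.map (θ.comp PowerSeries.C) := by
  have h := congrArg θ.mapMatrix (cayleySeries_mul_one_sub M)
  rw [map_mul, map_sub, map_add, map_one] at h
  rw [← scalar_mul_map_linearMatrix θ M hw, ← mul_one_sub, ← mul_one_add, ← h, ← mul_assoc,
    ← mul_assoc, (Matrix.scalar_commute w hc _).eq]
  rfl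

end Cayley

section Laurent

theorem commute_of_commute_coeff {A : Type*} [Ring A] {x y : A⸨X⸩}
    (h : ∀ i j, Commute (x.coeff i) (y.coeff j)) : Commute x y := by
  ext n
  rw [HahnSeries.coeff_mul, HahnSeries.coeff_mul]
  exact Finset.sum_equiv (Equiv.prodComm _ _)
    (fun _ => Finset.swap_mem_antidiagonal.symm) fun p _ => h p.1 p.2

theorem commute_single_one {A : Type*} [Ring A] (n : ℤ) (x : A⸨X⸩) :
    Commute (HahnSeries.single n 1) x :=
  commute_of_commute_coeff fun i j => by
    rw [HahnSeries.coeff_single]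
    split_ifs
    exacts [Commute.one_left _, Commute.zero_left _]

theorem single_mul_ofPowerSeries_X (A : Type*) [Ring A] :
    HahnSeries.single (-1) 1 * HahnSeries.ofPowerSeries ℤ A PowerSeries.X = 1 := by
  simp

theorem ofPowerSeries_comp_C (A : Type*) [Ring A] :
    (HahnSeries.ofPowerSeries ℤ A).comp PowerSeries.C = HahnSeries.C :=
  RingHom.ext HahnSeries.ofPowerSeries_C

variable {A B : Type*} [Ring A] [Ring B] (f : A →+* B)

theorem mapLaurent_coeff (x : A⸨X⸩) (n : ℤ) : (mapLaurent f x).coeff n = f (x.coeff n) := rfl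

theorem mapLaurent_C (a : A) : mapLaurent f (HahnSeries.C a) = HahnSeries.C (f a) :=
  HahnSeries.map_C a f

theorem mapLaurent_single (n : ℤ) (a : A) :
    mapLaurent f (HahnSeries.single n a) = HahnSeries.single n (f a) :=
  HahnSeries.map_single f.toMonoidWithZeroHom.toZeroHom

theorem mapLaurent_ofPowerSeries (p : A⟦X⟧) :
    mapLaurent f (HahnSeries.ofPowerSeries ℤ A p) =
      HahnSeries.ofPowerSeries ℤ B (PowerSeries.map f p) := by
  ext n
  rw [mapLaurent_coeff, PowerSeries.coeff_coe, PowerSeries.coeff_coe]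
  split_ifs
  exacts [map_zero f, (PowerSeries.coeff_map f _ p).symm]

/-- The embedding of `A` into `A((u⁻¹))((v⁻¹))` as constants. -/
def coeffs₂ (A : Type*) [Ring A] : A →+* Laurent₂ A :=
  (HahnSeries.C : A⸨X⸩ →+* Laurent₂ A).comp HahnSeries.C

theorem inU_comp_C : (inU A).comp PowerSeries.C = coeffs₂ A := by
  ext1 a
  simp [inU, coeffs₂]

theorem inV_comp_C : (inV A).comp PowerSeries.C = coeffs₂ A := by
  ext1 a
  simp [inV, coeffs₂]

variable [Algebra ℂ A]

theorem scalars₂_commute (z : Laurent₂ ℂ) (y : Laurent₂ A) : Commute (scalars₂ A z) y :=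
  commute_of_commute_coeff fun _ _ => commute_of_commute_coeff fun _ _ => Algebra.commutes _ _

theorem scalars₂_const₂ (z : ℂ) : scalars₂ A (const₂ z) = coeffs₂ A (algebraMap ℂ A z) := by
  simp only [scalars₂, const₂, coeffs₂, RingHom.comp_apply, mapLaurent_C]

theorem scalars₂_varU_mul_inU_X : scalars₂ A varU * inU A PowerSeries.X = 1 := by
  simp [inU, scalars₂, varU, mapLaurent_single]

theorem scalars₂_varV_mul_inV_X : scalars₂ A varV * inV A PowerSeries.X = 1 := by
  simp [inV, scalars₂, varV, mapLaurent_single]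

theorem C_add_const₂_mul_varV_ne_zero (x : ℂ⸨X⸩) {c : ℂ} (hc : c ≠ 0) :
    HahnSeries.C x + const₂ c * varV ≠ 0 := by
  intro h
  have h' := congrArg (fun z : Laurent₂ ℂ => (z.coeff (-1)).coeff 0) h
  simp [const₂, varV, HahnSeries.C_apply, HahnSeries.coeff_single_of_ne, hc] at h'

theorem varU_sub_varV_sub_const₂_ne_zero (k : ℂ) : varU - varV - const₂ k ≠ 0 := by
  convert C_add_const₂_mul_varV_ne_zero (HahnSeries.single (-1) 1 - HahnSeries.C k)
    (neg_ne_zero.2 one_ne_zero) using 1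
  simp only [varU, map_sub, map_neg, map_one, const₂, RingHom.comp_apply]
  ring

theorem varU_add_varV_sub_const₂_ne_zero (k : ℂ) : varU + varV - const₂ k ≠ 0 := by
  convert C_add_const₂_mul_varV_ne_zero (HahnSeries.single (-1) 1 - HahnSeries.C k)
    one_ne_zero using 1
  simp only [varU, map_sub, map_one, const₂, RingHom.comp_apply]
  ring

theorem varU_sub_varV_ne_zero : varU - varV ≠ 0 := by
  simpa only [map_zero, sub_zero] using varU_sub_varV_sub_const₂_ne_zero 0

theorem varU_add_varV_ne_zero : varU + varV ≠ 0 := by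
  simpa only [map_zero, sub_zero] using varU_add_varV_sub_const₂_ne_zero 0

end Laurent

section ReflectionEquation

variable {N : ℕ} {G : Matrix (Fin N) (Fin N) ℂ} {ε : ℤˣ}
variable (A : Type*) [Ring A] [Algebra ℂ A]

/-- The `ℂ((u⁻¹))((v⁻¹))`-algebra structure of `A((u⁻¹))((v⁻¹))`. -/
abbrev algebraLaurent₂ : Algebra (Laurent₂ ℂ) (Laurent₂ A) :=
  (scalars₂ A).toAlgebra' scalars₂_commute

attribute [local instance] algebraLaurent₂

variable {A}

theorem smul_eq_scalars₂_mul (z : Laurent₂ ℂ) (y : Laurent₂ A) : z • y = scalars₂ A z * y := rfl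

theorem mapMatrix_coeffs₂_smul {n : Type*} [Fintype n] [DecidableEq n] (k : ℂ)
    (T : Matrix n n A) :
    (coeffs₂ A).mapMatrix (k • T) = const₂ k • (coeffs₂ A).mapMatrix T := by
  ext i j : 2
  rw [RingHom.mapMatrix_apply, RingHom.mapMatrix_apply, Matrix.map_apply, Matrix.smul_apply,
    Matrix.smul_apply, Matrix.map_apply, Algebra.smul_def, map_mul, smul_eq_scalars₂_mul,
    scalars₂_const₂]

theorem map_opR_scalars₂ (z : Laurent₂ ℂ) :
    (opR G ε z).map (scalars₂ A) =
      rMatrix ((coeffs₂ A).mapMatrix ((opP N).map (algebraMap ℂ A)))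
        ((coeffs₂ A).mapMatrix ((opQ G).map (algebraMap ℂ A)))
        z⁻¹ (z - const₂ (kappa N ε))⁻¹ := by
  have hconst (T : Matrix (Fin N × Fin N) (Fin N × Fin N) ℂ) (c : Laurent₂ ℂ) :
      (c • T.map const₂).map (scalars₂ A) =
        c • (coeffs₂ A).mapMatrix (T.map (algebraMap ℂ A)) := by
    ext i j : 2
    rw [RingHom.mapMatrix_apply, Matrix.map_apply, Matrix.smul_apply, Matrix.smul_apply,
      Matrix.map_apply, Matrix.map_apply, Matrix.map_apply, smul_eq_mul, map_mul,
      scalars₂_const₂, smul_eq_scalars₂_mul]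
  rw [opR, rMatrix, ← hconst, ← hconst]
  exact (map_add (scalars₂ A).mapMatrix _ _).trans
    (congrArg₂ _ ((map_sub (scalars₂ A).mapMatrix _ _).trans
      (congrArg₂ _ (map_one (scalars₂ A).mapMatrix) rfl)) rfl)

theorem scalar_scalars₂ (n : Type*) [Fintype n] [DecidableEq n] (z : Laurent₂ ℂ) :
    Matrix.scalar n (scalars₂ A z) = z • 1 :=
  Algebra.algebraMap_eq_smul_one (A := Matrix n n (Laurent₂ A)) z

theorem reflection_cayleySeries (M : Matrix (Fin N) (Fin N) A)
    (h : IsReflectionQuadruple (kappa N ε) ((ε : ℤ) : ℂ) ((opP N).map (algebraMap ℂ A))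
      ((opQ G).map (algebraMap ℂ A)) (inFirst _ _ _ M) (inSecond _ _ _ M)) :
    reflLHS G ε (cayleySeries M) = reflRHS G ε (cayleySeries M) := by
  have hU := (isUnit_scalar_sub (inU A) M scalars₂_varU_mul_inU_X (scalars₂_commute _)).map
    (inFirst _ (Fin N) _)
  have hV := (isUnit_scalar_sub (inV A) M scalars₂_varV_mul_inV_X (scalars₂_commute _)).map
    (inSecond (Fin N) _ _)
  have hSU := congrArg (inFirst _ (Fin N) _)
    (map_cayleySeries_mul_scalar_sub (inU A) M scalars₂_varU_mul_inU_X (scalars₂_commute _))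
  have hSV := congrArg (inSecond (Fin N) _ _)
    (map_cayleySeries_mul_scalar_sub (inV A) M scalars₂_varV_mul_inV_X (scalars₂_commute _))
  rw [map_mul, map_sub, map_add] at hSU hSV
  rw [map_sub] at hU hV
  simp only [inU_comp_C, scalar_scalars₂, inFirst_smul_one, ← map_inFirst (coeffs₂ A) M] at hU hSU
  simp only [inV_comp_C, scalar_scalars₂, inSecond_smul_one, ← map_inSecond (coeffs₂ A) M]
    at hV hSV
  rw [reflLHS, reflRHS, map_opR_scalars₂, map_opR_scalars₂, ← inFirst_apply, ← inSecond_apply]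
  have hα := inv_mul_cancel₀ (G₀ := Laurent₂ ℂ) varU_sub_varV_ne_zero
  have hα' := inv_mul_cancel₀ (G₀ := Laurent₂ ℂ) varU_add_varV_ne_zero
  have hβ := inv_mul_cancel₀ (G₀ := Laurent₂ ℂ) (varU_sub_varV_sub_const₂_ne_zero (kappa N ε))
  have hβ' := inv_mul_cancel₀ (G₀ := Laurent₂ ℂ) (varU_add_varV_sub_const₂_ne_zero (kappa N ε))
  exact (h.map (coeffs₂ A).mapMatrix mapMatrix_coeffs₂_smul).reflection_equation
    hα hα' hβ hβ' hU hV hSU hSV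

theorem reflection_evalSeries (hdet : IsUnit G.det) (hG : Gᵀ = ((ε : ℤ) : ℂ) • G) :
    reflLHS G ε (evalSeries G) = reflRHS G ε (evalSeries G) :=
  reflection_cayleySeries _ (isReflectionQuadruple_shiftF hdet hG)

end ReflectionEquation

theorem isUnit_evalDen {N : ℕ} (G : Matrix (Fin N) (Fin N) ℂ) : IsUnit (evalDen G) := by
  rw [evalDen, ← ofPowerSeries_comp_C]
  exact isUnit_scalar_sub _ _ (single_mul_ofPowerSeries_X _) (commute_single_one (-1))

theorem map_evalSeries_mul_evalDen {N : ℕ} (G : Matrix (Fin N) (Fin N) ℂ) :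
    (evalSeries G).map (HahnSeries.ofPowerSeries ℤ (UgN G)) * evalDen G = evalNum G := by
  rw [evalDen, evalNum, ← ofPowerSeries_comp_C]
  exact map_cayleySeries_mul_scalar_sub _ _ (single_mul_ofPowerSeries_X _)
    (commute_single_one (-1))

theorem evalNum_mul_inverse_evalDen {N : ℕ} (G : Matrix (Fin N) (Fin N) ℂ) :
    evalNum G * Ring.inverse (evalDen G) =
      (evalSeries G).map (HahnSeries.ofPowerSeries ℤ (UgN G)) := by
  rw [← map_evalSeries_mul_evalDen, mul_assoc, Ring.mul_inverse_cancel _ (isUnit_evalDen G),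
    mul_one]

section Naturality

variable {N : ℕ} {A B : Type*} [Ring A] [Ring B]

theorem genMatrix_injective :
    Function.Injective (genMatrix : (Fin N → Fin N → ℕ+ → A) → _) := by
  intro s t h
  funext i j r
  have h' := congrArg (fun M : Matrix (Fin N) (Fin N) A⟦X⟧ => PowerSeries.coeff (r : ℕ) (M i j)) h
  simp only [genMatrix, Matrix.of_apply, PowerSeries.coeff_mk, r.pos, dif_pos] at h'
  exact h'

theorem map_genMatrix (ψ : A →+* B) (s : Fin N → Fin N → ℕ+ → A) :
    (genMatrix s).map (PowerSeries.map ψ) = genMatrix fun i j r => ψ (s i j r) := by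
  ext i j n
  simp only [genMatrix, Matrix.map_apply, Matrix.of_apply, PowerSeries.coeff_map,
    PowerSeries.coeff_mk]
  split_ifs <;> simp

theorem map_negArg (ψ : A →+* B) (p : A⟦X⟧) :
    PowerSeries.map ψ (negArg p) = negArg (PowerSeries.map ψ p) := by
  ext n
  simp [negArg]

variable [Algebra ℂ A] [Algebra ℂ B] (ψ : A →ₐ[ℂ] B)

/-- The map `A((u⁻¹))((v⁻¹)) → B((u⁻¹))((v⁻¹))` induced on coefficients. -/
def mapLaurent₂ : Laurent₂ A →+* Laurent₂ B :=
  mapLaurent (mapLaurent (ψ : A →+* B))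

theorem mapLaurent₂_comp_scalars₂ : (mapLaurent₂ ψ).comp (scalars₂ A) = scalars₂ B := by
  ext z m n
  simp [mapLaurent₂, scalars₂, mapLaurent_coeff]

theorem mapLaurent₂_comp_inU :
    (mapLaurent₂ ψ).comp (inU A) = (inU B).comp (PowerSeries.map (ψ : A →+* B)) := by
  ext1 p
  simp only [mapLaurent₂, inU, RingHom.comp_apply, mapLaurent_C, mapLaurent_ofPowerSeries]

theorem mapLaurent₂_comp_inV :
    (mapLaurent₂ ψ).comp (inV A) = (inV B).comp (PowerSeries.map (ψ : A →+* B)) := by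
  ext1 p
  simp only [mapLaurent₂, inV, RingHom.comp_apply, mapLaurent_ofPowerSeries]
  congr 1
  ext n : 1
  simp only [PowerSeries.coeff_map, mapLaurent_C]

theorem map_map_scalars₂ {n : Type*} (T : Matrix n n (Laurent₂ ℂ)) :
    (T.map (scalars₂ A)).map (mapLaurent₂ ψ) = T.map (scalars₂ B) := by
  rw [Matrix.map_map, ← RingHom.coe_comp, mapLaurent₂_comp_scalars₂]

theorem map_inFirst_map_inU (S : Matrix (Fin N) (Fin N) A⟦X⟧) :
    (inFirst (Fin N) (Fin N) _ (S.map (inU A))).map (mapLaurent₂ ψ) =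
      inFirst _ _ _ ((S.map (PowerSeries.map (ψ : A →+* B))).map (inU B)) := by
  rw [map_inFirst, Matrix.map_map, Matrix.map_map, ← RingHom.coe_comp, mapLaurent₂_comp_inU,
    RingHom.coe_comp]

theorem map_inSecond_map_inV (S : Matrix (Fin N) (Fin N) A⟦X⟧) :
    (inSecond (Fin N) (Fin N) _ (S.map (inV A))).map (mapLaurent₂ ψ) =
      inSecond _ _ _ ((S.map (PowerSeries.map (ψ : A →+* B))).map (inV B)) := by
  rw [map_inSecond, Matrix.map_map, Matrix.map_map, ← RingHom.coe_comp, mapLaurent₂_comp_inV,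
    RingHom.coe_comp]

variable (G : Matrix (Fin N) (Fin N) ℂ) (ε : ℤˣ) (S : Matrix (Fin N) (Fin N) A⟦X⟧)

theorem map_reflLHS :
    (reflLHS G ε S).map (mapLaurent₂ ψ) = reflLHS G ε (S.map (PowerSeries.map (ψ : A →+* B))) := by
  simp only [reflLHS, ← inFirst_apply, ← inSecond_apply, Matrix.map_mul, map_map_scalars₂,
    map_inFirst_map_inU, map_inSecond_map_inV]

theorem map_reflRHS :
    (reflRHS G ε S).map (mapLaurent₂ ψ) = reflRHS G ε (S.map (PowerSeries.map (ψ : A →+* B))) := by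
  simp only [reflRHS, ← inFirst_apply, ← inSecond_apply, Matrix.map_mul, map_map_scalars₂,
    map_inFirst_map_inU, map_inSecond_map_inV]

theorem map_mul_map_negArg :
    (S * S.map negArg).map (PowerSeries.map (ψ : A →+* B)) =
      S.map (PowerSeries.map (ψ : A →+* B)) *
        (S.map (PowerSeries.map (ψ : A →+* B))).map negArg := by
  rw [Matrix.map_mul]
  congr 1
  ext1 i j
  exact map_negArg _ _

end Naturality

section Homomorphism

variable {N : ℕ} {G : Matrix (Fin N) (Fin N) ℂ} {ε : ℤˣ} {A : Type*} [Ring A] [Algebra ℂ A]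

theorem lift_eq_of_rel {s : Fin N → Fin N → ℕ+ → A}
    (hr : reflLHS G ε (genMatrix s) = reflRHS G ε (genMatrix s))
    (hu : genMatrix s * (genMatrix s).map negArg = 1) {x y : FreeB N} (h : Rel G ε x y) :
    FreeAlgebra.lift ℂ (fun p => s p.1 p.2.1 p.2.2) x =
      FreeAlgebra.lift ℂ (fun p => s p.1 p.2.1 p.2.2) y := by
  set ψ : FreeB N →ₐ[ℂ] A := FreeAlgebra.lift ℂ fun p => s p.1 p.2.1 p.2.2
  have hS : (freeS N).map (PowerSeries.map (ψ : FreeB N →+* A)) = genMatrix s := by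
    rw [freeS, map_genMatrix]
    simp [ψ]
  cases h with
  | reflection p q m n =>
    have h : (reflLHS G ε (freeS N)).map (mapLaurent₂ ψ) =
        (reflRHS G ε (freeS N)).map (mapLaurent₂ ψ) := by
      rw [map_reflLHS, map_reflRHS, hS, hr]
    exact congrArg (fun T : Matrix _ _ (Laurent₂ A) => ((T p q).coeff m).coeff n) h
  | unitary i j n =>
    have h : (freeS N * (freeS N).map negArg).map (PowerSeries.map (ψ : FreeB N →+* A)) =
        (PowerSeries.map (ψ : FreeB N →+* A)).mapMatrix 1 := by
      rw [map_mul_map_negArg, hS, hu, map_one]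
    have h' := congrArg (fun T : Matrix (Fin N) (Fin N) A⟦X⟧ => PowerSeries.coeff n (T i j)) h
    simp only [RingHom.mapMatrix_apply, Matrix.map_apply, PowerSeries.coeff_map] at h'
    exact h'

theorem exists_algHom_of_relations {s : Fin N → Fin N → ℕ+ → A}
    (hr : reflLHS G ε (genMatrix s) = reflRHS G ε (genMatrix s))
    (hu : genMatrix s * (genMatrix s).map negArg = 1) :
    ∃ φ : B G ε →ₐ[ℂ] A, (matS G ε).map (PowerSeries.map (φ : B G ε →+* A)) = genMatrix s := by
  refine ⟨RingQuot.liftAlgHom ℂ ⟨FreeAlgebra.lift ℂ fun p => s p.1 p.2.1 p.2.2,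
    fun _ _ h => lift_eq_of_rel hr hu h⟩, ?_⟩
  rw [matS, map_genMatrix]
  simp [genB]

theorem algHom_ext_matS {φ φ' : B G ε →ₐ[ℂ] A}
    (h : (matS G ε).map (PowerSeries.map (φ : B G ε →+* A)) =
      (matS G ε).map (PowerSeries.map (φ' : B G ε →+* A))) : φ = φ' := by
  rw [matS, map_genMatrix, map_genMatrix] at h
  refine RingQuot.ringQuot_ext' _ _ _ (FreeAlgebra.hom_ext ?_)
  funext ⟨i, j, r⟩
  exact congrFun (congrFun₂ (genMatrix_injective h) i j) r

end Homomorphism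

end ReflectionAlgebra

end

theorem theorem3p3 (N : ℕ) (G : Matrix (Fin N) (Fin N) ℂ) (hdet : IsUnit G.det)
    (ε : ℤˣ) (hG : G.transpose = ((ε : ℤ) : ℂ) • G) :
    IsUnit (ReflectionAlgebra.evalDen G) ∧
    ReflectionAlgebra.evalNum G * Ring.inverse (ReflectionAlgebra.evalDen G) =
      (ReflectionAlgebra.evalSeries G).map
        (HahnSeries.ofPowerSeries ℤ (ReflectionAlgebra.UgN G)) ∧
    ∃! φ : ReflectionAlgebra.B G ε →ₐ[ℂ] ReflectionAlgebra.UgN G,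
      ((ReflectionAlgebra.matS G ε).map (PowerSeries.map (φ : _ →+* _))).map
          (HahnSeries.ofPowerSeries ℤ (ReflectionAlgebra.UgN G)) =
        ReflectionAlgebra.evalNum G * Ring.inverse (ReflectionAlgebra.evalDen G) := by
  open ReflectionAlgebra in
  refine ⟨isUnit_evalDen G, evalNum_mul_inverse_evalDen G, ?_⟩
  obtain ⟨φ, hφ⟩ := exists_algHom_of_relations (reflection_evalSeries hdet hG)
    (cayleySeries_mul_map_negArg (shiftF G))
  rw [evalNum_mul_inverse_evalDen]
  exact ⟨φ, congrArg (Matrix.map · _) hφ, fun φ' hφ' => algHom_ext_matS <|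
    (Matrix.map_injective HahnSeries.ofPowerSeries_injective hφ').trans hφ.symm⟩
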